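/- For integers $n\ge k\ge 0$, the Kneser graph $KG(n,k)$ has as vertices the $k$-element subsets of $[n]=\{1,\dots,n\}$, two distinct vertices being adjacent if and only if they are disjoint. A graph $G$ contains a graph $H$ as a subdivision if there are an injection $\varphi\colon V(H)\to V(G)$, whose values are called terminals, and, for every edge $uv$ of $H$, a path $P_{uv}$ in $G$ between $\varphi(u)$ and $\varphi(v)$, such that no terminal is an internal vertex of any of these paths and the paths are pairwise internally vertex-disjoint. The subdivision is totally odd if all the paths $P_{uv}$ have odd length. Theorem. (1) Every Kneser graph $G$ contains $K_{\chi(G)}$ as a totally odd subdivision. (2) If $r\ge k\ge 1$, then $KG(2k+r,k)$ contains $K_{r+2}$ as a totally odd subdivision in which every path has length $1$ or $3$. If $k=2$, this holds with the $r+2$ terminals $\{1,2\}$ and $\{i+3,i+4\}$, $0\le i\le r$. If $k\ge 3$, it holds with the $r+2$ terminals $$Y=\{1,\dots,k\},\qquad X_i=\{k+1,\dots,2k-1\}\cup\{2k+i\}\quad(0\le i\le r),$$ where the path between $Y$ and each $X_i$ has length $1$, and the path between $X_i$ and $X_j$ has length $3$ for all $i\ne j$. (3) If $3\le r<k$, then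 $KG(2k+r,k)$ contains $K_{r+2}$ as a totally odd subdivision with the same terminals $Y,X_0,\dots,X_r$, where the path between $Y$ and each $X_i$ has length $1$, and the path between $X_i$ and $X_j$ has length $2\lceil (k-1)/r\rceil+1$ for all $i\ne j$. -/

import Mathlib

/-- The Kneser graph `KG(n, k)`: its vertices are the `k`-element subsets of `[n] = {1, …, n}`, and
two distinct vertices are adjacent when they are disjoint. For `k ≥ 1` distinctness is automatic;
for `k = 0` it keeps the graph loopless. -/
def kneserGraph (n k : ℕ) :
    SimpleGraph {A : Finset ℕ // A ∈ Finset.powersetCard k (Finset.Icc 1 n)} where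
  Adj A B := A ≠ B ∧ Disjoint A.1 B.1
  symm := ⟨fun _ _ h => ⟨h.1.symm, h.2.symm⟩⟩
  loopless := ⟨fun _ h => h.1 rfl⟩

/-- The internal vertices of a path: its vertices other than the two ends. -/
def internalVertices {W : Type*} {G : SimpleGraph W} {a b : W} (p : G.Walk a b) : Set W :=
  {x | x ∈ p.support ∧ x ≠ a ∧ x ≠ b}

/-- A subdivision of `H` contained in `G`: an injection of the vertices of `H` into those of `G`
(its values are the terminals), and for each edge `uv` of `H` one path of `G` between the
corresponding terminals, such that no terminal is an internal vertex of a path and the paths of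
different edges have no internal vertex in common. -/
structure GraphSubdivision {V W : Type*} (H : SimpleGraph V) (G : SimpleGraph W) where
  /-- The terminals. -/
  terminal : V ↪ W
  /-- The path of each edge, written once for each of the two orientations of the edge. -/
  path : ∀ u v : V, H.Adj u v → G.Walk (terminal u) (terminal v)
  isPath : ∀ (u v : V) (h : H.Adj u v), (path u v h).IsPath
  path_symm : ∀ (u v : V) (h : H.Adj u v), path v u h.symm = (path u v h).reverse
  terminal_not_internal : ∀ (u v : V) (h : H.Adj u v) (w : V),
    terminal w ∉ internalVertices (path u v h)
  internally_disjoint : ∀ (u v : V) (h : H.Adj u v) (u' v' : V) (h' : H.Adj u' v'),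
    s(u, v) ≠ s(u', v') →
      Disjoint (internalVertices (path u v h)) (internalVertices (path u' v' h'))

/-- A subdivision is totally odd when all of its paths have odd length. -/
def GraphSubdivision.IsTotallyOdd {V W : Type*} {H : SimpleGraph V} {G : SimpleGraph W}
    (S : GraphSubdivision H G) : Prop :=
  ∀ (u v : V) (h : H.Adj u v), Odd (S.path u v h).length

/-- The terminals of a subdivision of `K_{r+2}` in `KG(2k+r, k)` are
`Y = {1, …, k}` and `X_i = {k+1, …, 2k-1} ∪ {2k+i}` for `0 ≤ i ≤ r`, the path from `Y` to each
`X_i` has length `1`, and the path from `X_i` to `X_j` has length `ℓ` for all `i ≠ j`. -/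
def HasStandardForm (k r ℓ : ℕ)
    (S : GraphSubdivision (⊤ : SimpleGraph (Fin (r + 2))) (kneserGraph (2 * k + r) k)) : Prop :=
  (S.terminal 0).1 = Finset.Icc 1 k ∧
  (∀ i : Fin (r + 1),
    (S.terminal i.succ).1 = Finset.Icc (k + 1) (2 * k - 1) ∪ {2 * k + (i : ℕ)}) ∧
  (∀ (i : Fin (r + 1)) (h : (⊤ : SimpleGraph (Fin (r + 2))).Adj 0 i.succ),
    (S.path 0 i.succ h).length = 1) ∧
  (∀ (i j : Fin (r + 1)) (h : (⊤ : SimpleGraph (Fin (r + 2))).Adj i.succ j.succ),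
    (S.path i.succ j.succ h).length = ℓ)

/-! For `k ≥ 1`, colouring sets by their least element gives χ(KG(2k+r, k)) ≤ r + 2. This bound is
all that part (1) needs: a totally odd subdivision of K_{r+2} contains one of each smaller complete
graph, so the exact chromatic number never enters. A Kneser graph not of this form is edgeless.

For `k ≥ 2` outside the case `k = 2 ≤ r`, [2k+r] is cut into blocks {1..k}, {k+1..2k-1} and
{2k..2k+r}. The set Y is the first block and X_i is the middle block with one point of the last, so
Y is adjacent to every X_i; what remains is to join X_i to X_j for i < j. Every internal vertex must
encode i, j and its position, which makes the paths internally disjoint.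

If r < k, the path moves r points at a time. The vertex at position 2s+1 consists of {1..k} without
the cyclic interval of length sr+1 from i+1, the first sr points of the middle block, and 2k+j. The
one at position 2s > 0 consists of the cyclic interval of length (s-1)r+1 from i+1, the middle block
without its first sr points, and the last block without 2k+j. Lengths are truncated once the middle
block is exhausted. The last block shows the parity and j, the middle block shows s, and the start
of the cyclic interval shows i. The path reaches X_j when sr ≥ k-1.

If r ≥ k ≥ 3, two internal vertices suffice. The first encodes (i, j) directly; the second carries a
(k-1)-subset of the last block that avoids two given points, and Hall's theorem makes these subsets
distinct (`exists_injective_disjoint_powersetCard`). The cases k = 1 and k = 2 with r ≥ k are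
explicit. -/

/-! ### Subdivisions of complete graphs from vertex sequences -/

/-- A sequence of consecutively adjacent vertices is the vertex sequence of a walk. -/
theorem exists_walk_of_sequence {W : Type*} {G : SimpleGraph W} (n : ℕ) (z : ℕ → W)
    (hz : ∀ t < n, G.Adj (z t) (z (t + 1))) :
    ∃ p : G.Walk (z 0) (z n), p.length = n ∧ p.support = (List.range (n + 1)).map z := by
  induction n with
  | zero => exact ⟨.nil, rfl, rfl⟩
  | succ n ih =>
    obtain ⟨p, hl, hs⟩ := ih fun t ht => hz t (by omega)
    refine ⟨p.concat (hz n (by omega)), by simp [hl], ?_⟩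
    rw [SimpleGraph.Walk.support_concat, hs, List.range_succ (n := n + 1)]
    simp

/-- A path running through given internal vertices. -/
theorem exists_path_of_sequence {W : Type*} {G : SimpleGraph W} {a b : W} (hab : a ≠ b)
    (n : ℕ) (z : ℕ → W) (h0 : z 0 = a) (hn : z n = b)
    (hz : ∀ t < n, G.Adj (z t) (z (t + 1)))
    (hend : ∀ t, 0 < t → t < n → z t ≠ a ∧ z t ≠ b)
    (hinj : ∀ t t', 0 < t → t < n → 0 < t' → t' < n → z t = z t' → t = t') :
    ∃ p : G.Walk a b, p.IsPath ∧ p.length = n ∧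
      ∀ x ∈ internalVertices p, ∃ t, 0 < t ∧ t < n ∧ x = z t := by
  subst h0 hn
  obtain ⟨p, hl, hs⟩ := exists_walk_of_sequence n z hz
  refine ⟨p, ?_, hl, ?_⟩
  · rw [SimpleGraph.Walk.isPath_def, hs]
    refine List.Nodup.map_on ?_ List.nodup_range
    intro t ht t' ht' h
    rw [List.mem_range] at ht ht'
    by_contra hne
    have e : ∀ s, s < n + 1 → s = 0 ∨ s = n ∨ (0 < s ∧ s < n) := fun s hs => by omega
    rcases e t ht with rfl | rfl | ⟨h1, h2⟩ <;> rcases e t' ht' with rfl | rfl | ⟨h3, h4⟩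
    · exact hne rfl
    · exact hab h
    · exact (hend _ h3 h4).1 h.symm
    · exact hab h.symm
    · exact hne rfl
    · exact (hend _ h3 h4).2 h.symm
    · exact (hend _ h1 h2).1 h
    · exact (hend _ h1 h2).2 h
    · exact hne (hinj _ _ h1 h2 h3 h4 h)
  · rintro x ⟨hx, hxa, hxb⟩
    rw [hs, List.mem_map] at hx
    obtain ⟨t, ht, rfl⟩ := hx
    rw [List.mem_range] at ht
    refine ⟨t, Nat.pos_of_ne_zero ?_, lt_of_le_of_ne (by omega) ?_, rfl⟩
    · rintro rfl; exact hxa rfl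
    · rintro rfl; exact hxb rfl

theorem internalVertices_reverse {W : Type*} {G : SimpleGraph W} {a b : W} (p : G.Walk a b) :
    internalVertices p.reverse = internalVertices p := by
  ext x
  simp only [internalVertices, Set.mem_ofPred_eq, SimpleGraph.Walk.support_reverse,
    List.mem_reverse]
  tauto

/-- Sequences of vertices between prescribed terminals give a subdivision of a complete graph. -/
theorem exists_subdivision_of_sequences {W : Type*} {G : SimpleGraph W} {m : ℕ} (x : Fin m ↪ W)
    (ℓ : Fin m → Fin m → ℕ) (z : Fin m → Fin m → ℕ → W)
    (h0 : ∀ u v, u < v → z u v 0 = x u) (hℓ : ∀ u v, u < v → z u v (ℓ u v) = x v)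
    (hz : ∀ u v, u < v → ∀ t < ℓ u v, G.Adj (z u v t) (z u v (t + 1)))
    (hend : ∀ u v, u < v → ∀ t, 0 < t → t < ℓ u v → ∀ w, z u v t ≠ x w)
    (hinj : ∀ u v u' v' t t', u < v → u' < v' → 0 < t → t < ℓ u v → 0 < t' → t' < ℓ u' v' →
      z u v t = z u' v' t' → u = u' ∧ v = v' ∧ t = t') :
    ∃ S : GraphSubdivision (⊤ : SimpleGraph (Fin m)) G, S.terminal = x ∧
      (∀ u v h, u < v → (S.path u v h).length = ℓ u v) ∧
      (∀ u v h, v < u → (S.path u v h).length = ℓ v u) := by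
  have key : ∀ u v, u < v → ∃ p : G.Walk (x u) (x v), p.IsPath ∧ p.length = ℓ u v ∧
      ∀ y ∈ internalVertices p, ∃ t, 0 < t ∧ t < ℓ u v ∧ y = z u v t := fun u v huv =>
    exists_path_of_sequence (x.injective.ne huv.ne) (ℓ u v) (z u v) (h0 u v huv) (hℓ u v huv)
      (hz u v huv) (fun t h1 h2 => ⟨hend u v huv t h1 h2 u, hend u v huv t h1 h2 v⟩)
      (fun t t' h1 h2 h3 h4 h => (hinj u v u v t t' huv huv h1 h2 h3 h4 h).2.2)
  choose p hp hl hi using key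
  -- Sequences are given only for `u < v`; using the reversed path for `v < u` makes the symmetry of
  -- the paths automatic.
  let P : ∀ u v : Fin m, u ≠ v → G.Walk (x u) (x v) := fun u v h =>
    if huv : u < v then p u v huv else (p v u (lt_of_le_of_ne (not_lt.1 huv) h.symm)).reverse
  have P1 : ∀ u v h (huv : u < v), P u v h = p u v huv := fun u v h huv => dif_pos huv
  have P2 : ∀ u v h (hvu : v < u), P u v h = (p v u hvu).reverse := fun u v h hvu =>
    dif_neg (not_lt.2 hvu.le)
  have hint : ∀ u v h, ∀ y ∈ internalVertices (P u v h), ∃ u' v' t, u' < v' ∧ s(u, v) = s(u', v') ∧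
      0 < t ∧ t < ℓ u' v' ∧ y = z u' v' t := by
    intro u v h y hy
    rcases lt_or_gt_of_ne h with huv | hvu
    · rw [P1 u v h huv] at hy
      obtain ⟨t, ht⟩ := hi u v huv y hy
      exact ⟨u, v, t, huv, rfl, ht⟩
    · rw [P2 u v h hvu, internalVertices_reverse] at hy
      obtain ⟨t, ht⟩ := hi v u hvu y hy
      exact ⟨v, u, t, hvu, Sym2.eq_swap, ht⟩
  refine ⟨⟨x, fun u v h => P u v h.ne, ?_, ?_, ?_, ?_⟩, rfl, ?_, ?_⟩
  · intro u v h
    rcases lt_or_gt_of_ne h.ne with huv | hvu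
    · rw [P1 u v h.ne huv]; exact hp u v huv
    · rw [P2 u v h.ne hvu]; exact (hp v u hvu).reverse
  · intro u v h
    rcases lt_or_gt_of_ne h.ne with huv | hvu
    · rw [P1 u v h.ne huv, P2 v u h.ne.symm huv]
    · rw [P2 u v h.ne hvu, P1 v u h.ne.symm hvu, SimpleGraph.Walk.reverse_reverse]
  · intro u v h w hw
    obtain ⟨u', v', t, huv, -, h1, h2, h3⟩ := hint u v h.ne _ hw
    exact hend u' v' huv t h1 h2 w h3.symm
  · intro u v h u' v' h' hne
    rw [Set.disjoint_left]
    intro y hy hy'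
    obtain ⟨a, b, t, hab, e, h1, h2, h3⟩ := hint u v h.ne _ hy
    obtain ⟨a', b', t', hab', e', h1', h2', h3'⟩ := hint u' v' h'.ne _ hy'
    obtain ⟨rfl, rfl, -⟩ := hinj a b a' b' t t' hab hab' h1 h2 h1' h2' (h3.symm.trans h3')
    exact hne (e.trans e'.symm)
  · intro u v h huv
    exact (congrArg _ (P1 u v h.ne huv)).trans (hl u v huv)
  · intro u v h hvu
    refine (congrArg _ (P2 u v h.ne hvu)).trans ?_
    rw [SimpleGraph.Walk.length_reverse, hl v u hvu]

/-- A subdivision of a complete graph contains subdivisions of the smaller complete graphs. -/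
theorem GraphSubdivision.exists_isTotallyOdd_of_le {W : Type*} {G : SimpleGraph W} {m t : ℕ}
    (htm : t ≤ m) (S : GraphSubdivision (⊤ : SimpleGraph (Fin m)) G) (hS : S.IsTotallyOdd) :
    ∃ S' : GraphSubdivision (⊤ : SimpleGraph (Fin t)) G, S'.IsTotallyOdd := by
  have inj := Fin.castLE_injective htm
  have adj : ∀ {u v : Fin t}, (⊤ : SimpleGraph (Fin t)).Adj u v →
      (⊤ : SimpleGraph (Fin m)).Adj (u.castLE htm) (v.castLE htm) := fun h => inj.ne h.ne
  refine ⟨⟨⟨fun u => S.terminal (u.castLE htm), S.terminal.injective.comp inj⟩,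
    fun u v h => S.path _ _ (adj h), fun u v h => S.isPath _ _ _,
    fun u v h => S.path_symm _ _ (adj h), fun u v h w => S.terminal_not_internal _ _ (adj h) _,
    fun u v h u' v' h' hne => S.internally_disjoint _ _ (adj h) _ _ (adj h') ?_⟩,
    fun u v h => hS _ _ (adj h)⟩
  intro e
  refine hne (Sym2.map.injective inj ?_)
  simpa using e

/-! ### Reduction to sequences of sets in a Kneser graph -/

/-- Paths given by sequences of sets, between terminals `X 0, …, X r` disjoint from `{1, …, k}`,
give a subdivision of a complete graph in a Kneser graph. -/
theorem exists_subdivision_kneserGraph {k r : ℕ} (hk : 1 ≤ k) (X : ℕ → Finset ℕ)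
    (ℓ : ℕ → ℕ → ℕ) (z : ℕ → ℕ → ℕ → Finset ℕ)
    (hX : ∀ i ≤ r, X i ⊆ Finset.Icc (k + 1) (2 * k + r) ∧ (X i).card = k)
    (hXinj : ∀ i ≤ r, ∀ j ≤ r, X i = X j → i = j)
    (h0 : ∀ i j, i < j → j ≤ r → z i j 0 = X i)
    (hℓ : ∀ i j, i < j → j ≤ r → z i j (ℓ i j) = X j)
    (hmem : ∀ i j, i < j → j ≤ r → ∀ t ≤ ℓ i j,
      z i j t ⊆ Finset.Icc 1 (2 * k + r) ∧ (z i j t).card = k)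
    (hdisj : ∀ i j, i < j → j ≤ r → ∀ t < ℓ i j, Disjoint (z i j t) (z i j (t + 1)))
    (hend : ∀ i j, i < j → j ≤ r → ∀ t, 0 < t → t < ℓ i j →
      z i j t ≠ Finset.Icc 1 k ∧ ∀ l ≤ r, z i j t ≠ X l)
    (hinj : ∀ i j i' j' t t', i < j → j ≤ r → i' < j' → j' ≤ r → 0 < t → t < ℓ i j → 0 < t' →
      t' < ℓ i' j' → z i j t = z i' j' t' → i = i' ∧ j = j' ∧ t = t') :
    ∃ S : GraphSubdivision (⊤ : SimpleGraph (Fin (r + 2))) (kneserGraph (2 * k + r) k),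
      (S.terminal 0).1 = Finset.Icc 1 k ∧
      (∀ i : Fin (r + 1), (S.terminal i.succ).1 = X i) ∧
      (∀ i h, (S.path 0 (Fin.succ i) h).length = 1) ∧
      (∀ i h, (S.path (Fin.succ i) 0 h).length = 1) ∧
      (∀ i j h, i < j → (S.path (Fin.succ i) (Fin.succ j) h).length = ℓ i j) ∧
      (∀ i j h, j < i → (S.path (Fin.succ i) (Fin.succ j) h).length = ℓ j i) := by
  classical
  have hY : Finset.Icc 1 k ∈ Finset.powersetCard k (Finset.Icc 1 (2 * k + r)) := by
    rw [Finset.mem_powersetCard]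
    exact ⟨Finset.Icc_subset_Icc_right (by omega), by simp⟩
  -- The value {1..k} outside the vertex set is a filler: `toV` is only evaluated where `toV_val`
  -- applies.
  let toV : Finset ℕ → {A : Finset ℕ // A ∈ Finset.powersetCard k (Finset.Icc 1 (2 * k + r))} :=
    fun A => if h : A ∈ Finset.powersetCard k (Finset.Icc 1 (2 * k + r)) then ⟨A, h⟩ else ⟨_, hY⟩
  have toV_val : ∀ A : Finset ℕ, A ⊆ Finset.Icc 1 (2 * k + r) ∧ A.card = k → (toV A).1 = A :=
    fun A h => by simp only [toV]; rw [dif_pos (Finset.mem_powersetCard.2 h)]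
  have adj : ∀ A B, A.1.card = k → Disjoint A.1 B.1 → (kneserGraph (2 * k + r) k).Adj A B := by
    intro A B hA hAB
    refine ⟨?_, hAB⟩
    rintro rfl
    rw [disjoint_self, Finset.bot_eq_empty] at hAB
    rw [hAB, Finset.card_empty] at hA
    omega
  have hX' : ∀ i ≤ r, (toV (X i)).1 = X i := fun i hi => toV_val _
    ⟨(hX i hi).1.trans (Finset.Icc_subset_Icc_left (by omega)), (hX i hi).2⟩
  have hz' : ∀ i j, i < j → j ≤ r → ∀ t ≤ ℓ i j, (toV (z i j t)).1 = z i j t :=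
    fun i j hij hj t ht => toV_val _ (hmem i j hij hj t ht)
  have dYX : ∀ i ≤ r, Disjoint (Finset.Icc 1 k) (X i) := by
    intro i hi
    refine Finset.disjoint_of_subset_right (hX i hi).1 ?_
    rw [Finset.disjoint_left]
    intro a; simp only [Finset.mem_Icc]; omega
  have YX : ∀ i ≤ r, (Finset.Icc 1 k) ≠ X i := by
    intro i hi h
    have := dYX i hi
    rw [← h, disjoint_self, Finset.bot_eq_empty] at this
    have h1 : (1 : ℕ) ∈ Finset.Icc 1 k := by simp [hk]
    rw [this] at h1
    simp at h1
  have le : ∀ i : Fin (r + 1), (i : ℕ) ≤ r := fun i => by omega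
  let x : Fin (r + 2) ↪ _ := ⟨Fin.cons ⟨_, hY⟩ fun i : Fin (r + 1) => toV (X i), by
    intro u v
    cases u using Fin.cases with
    | zero =>
      cases v using Fin.cases with
      | zero => exact fun _ => rfl
      | succ j =>
        intro h
        have := congrArg Subtype.val h
        simp only [Fin.cons_zero, Fin.cons_succ, hX' j (le j)] at this
        exact (YX j (le j) this).elim
    | succ i =>
      cases v using Fin.cases with
      | zero =>
        intro h
        have := congrArg Subtype.val h
        simp only [Fin.cons_zero, Fin.cons_succ, hX' i (le i)] at this
        exact (YX i (le i) this.symm).elim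
      | succ j =>
        intro h
        have := congrArg Subtype.val h
        simp only [Fin.cons_succ, hX' i (le i), hX' j (le j)] at this
        exact congrArg _ (Fin.ext (hXinj _ (le i) _ (le j) this))⟩
  have x0 : (x 0).1 = Finset.Icc 1 k := rfl
  have xs : ∀ i : Fin (r + 1), x i.succ = toV (X i) := fun i => rfl
  -- Index 0 stands for Y and index u ≥ 1 for X_{u-1}, so the subtraction is exact where it is used.
  let ℓ' : Fin (r + 2) → Fin (r + 2) → ℕ :=
    fun u v => if u = 0 then 1 else ℓ (u - 1 : ℕ) (v - 1 : ℕ)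
  let z' : Fin (r + 2) → Fin (r + 2) → ℕ → _ :=
    fun u v t => if u = 0 then (if t = 0 then x 0 else x v) else toV (z (u - 1 : ℕ) (v - 1 : ℕ) t)
  have ℓ0 : ∀ v, ℓ' 0 v = 1 := fun v => if_pos rfl
  have ℓs : ∀ i j : Fin (r + 1), ℓ' i.succ j.succ = ℓ i j := fun i j => by
    simp [ℓ', Fin.succ_ne_zero]
  have zs : ∀ (i j : Fin (r + 1)) t, z' i.succ j.succ t = toV (z i j t) := fun i j t => by
    simp [z', Fin.succ_ne_zero]
  have split : ∀ u v : Fin (r + 2), u < v → (u = 0 ∧ ∃ j : Fin (r + 1), v = j.succ) ∨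
      ∃ i j : Fin (r + 1), i < j ∧ u = i.succ ∧ v = j.succ := by
    intro u v huv
    cases v using Fin.cases with
    | zero => exact (Fin.not_lt_zero _ huv).elim
    | succ j =>
      cases u using Fin.cases with
      | zero => exact .inl ⟨rfl, j, rfl⟩
      | succ i => exact .inr ⟨i, j, Fin.succ_lt_succ_iff.1 huv, rfl, rfl⟩
  refine Exists.elim (exists_subdivision_of_sequences
    (G := kneserGraph (2 * k + r) k) x ℓ' z' ?_ ?_ ?_ ?_ ?_) ?_
  rotate_left 5
  · rintro S ⟨hS, h1, h2⟩
    refine ⟨S, by rw [hS, x0], fun i => by rw [hS, xs, hX' i (le i)], ?_, ?_, ?_, ?_⟩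
    · intro i h; rw [h1 _ _ h (Fin.succ_pos i), ℓ0]
    · intro i h; rw [h2 _ _ h (Fin.succ_pos i), ℓ0]
    · intro i j h hij; rw [h1 _ _ h (Fin.succ_lt_succ_iff.2 hij), ℓs]
    · intro i j h hij; rw [h2 _ _ h (Fin.succ_lt_succ_iff.2 hij), ℓs]
  · intro u v huv
    rcases split u v huv with ⟨rfl, j, rfl⟩ | ⟨i, j, hij, rfl, rfl⟩
    · simp [z']
    · rw [zs, h0 i j hij (le j), xs]
  · intro u v huv
    rcases split u v huv with ⟨rfl, j, rfl⟩ | ⟨i, j, hij, rfl, rfl⟩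
    · rw [ℓ0]; simp [z']
    · rw [zs, ℓs, hℓ i j hij (le j), xs]
  · intro u v huv t ht
    rcases split u v huv with ⟨rfl, j, rfl⟩ | ⟨i, j, hij, rfl, rfl⟩
    · rw [ℓ0] at ht
      obtain rfl : t = 0 := by omega
      have : (kneserGraph (2 * k + r) k).Adj (x 0) (x j.succ) := by
        refine adj _ _ (by rw [x0]; simp) ?_
        rw [x0, xs, hX' j (le j)]
        exact dYX j (le j)
      simpa [z'] using this
    · rw [ℓs] at ht
      rw [zs, zs]
      refine adj _ _ ?_ ?_
      · rw [hz' i j hij (le j) t ht.le]; exact (hmem i j hij (le j) t ht.le).2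
      · rw [hz' i j hij (le j) t ht.le, hz' i j hij (le j) (t + 1) ht]
        exact hdisj i j hij (le j) t ht
  · intro u v huv t ht ht' w hw
    rcases split u v huv with ⟨rfl, j, rfl⟩ | ⟨i, j, hij, rfl, rfl⟩
    · rw [ℓ0] at ht'; omega
    · rw [ℓs] at ht'
      have hw' := congrArg Subtype.val hw
      rw [zs, hz' i j hij (le j) t ht'.le] at hw'
      cases w using Fin.cases with
      | zero => exact (hend i j hij (le j) t ht ht').1 hw'
      | succ l =>
        rw [xs, hX' l (le l)] at hw'
        exact (hend i j hij (le j) t ht ht').2 l (le l) hw'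
  · intro u v u' v' t t' huv huv' h1 h2 h1' h2' h
    rcases split u v huv with ⟨rfl, j, rfl⟩ | ⟨i, j, hij, rfl, rfl⟩
    · rw [ℓ0] at h2; omega
    rcases split u' v' huv' with ⟨rfl, j', rfl⟩ | ⟨i', j', hij', rfl, rfl⟩
    · rw [ℓ0] at h2'; omega
    rw [ℓs] at h2 h2'
    have hw' := congrArg Subtype.val h
    rw [zs, zs, hz' i j hij (le j) t h2.le, hz' i' j' hij' (le j') t' h2'.le] at hw'
    obtain ⟨e1, e2, e3⟩ := hinj i j i' j' t t' hij (le j) hij' (le j') h1 h2 h1' h2' hw'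
    exact ⟨congrArg _ (Fin.ext e1), congrArg _ (Fin.ext e2), e3⟩

/-! ### Upper bound on the chromatic number -/

/-- The least element is the colour, with all values from r + 2 on merged. Disjoint sets have
different minima, and two k-sets with minimum at least r + 2 lie in a set of 2k - 1 elements, hence
meet. -/
theorem kneserGraph_colorable {k : ℕ} (hk : 1 ≤ k) (r : ℕ) :
    (kneserGraph (2 * k + r) k).Colorable (r + 2) := by
  have ne : ∀ A : {A : Finset ℕ // A ∈ Finset.powersetCard k (Finset.Icc 1 (2 * k + r))},
      A.1.Nonempty := fun A => by
    rw [← Finset.card_pos, (Finset.mem_powersetCard.1 A.2).2]; omega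
  refine ⟨SimpleGraph.Coloring.mk
    (fun A => (⟨min (A.1.min' (ne A)) (r + 2) - 1, by omega⟩ : Fin (r + 2))) ?_⟩
  intro A B hAB h
  have h := congrArg Fin.val h
  simp only at h
  have hA := Finset.mem_powersetCard.1 A.2
  have hB := Finset.mem_powersetCard.1 B.2
  have mA := Finset.min'_mem _ (ne A)
  have mB := Finset.min'_mem _ (ne B)
  have pA := (Finset.mem_Icc.1 (hA.1 mA)).1
  have pB := (Finset.mem_Icc.1 (hB.1 mB)).1
  by_cases hlt : A.1.min' (ne A) < r + 2
  · have e : A.1.min' (ne A) = B.1.min' (ne B) := by omega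
    rw [← e] at mB
    exact (Finset.disjoint_left.1 hAB.2) mA mB
  · have sub : A.1 ∪ B.1 ⊆ Finset.Icc (r + 2) (2 * k + r) := by
      intro a ha
      rcases Finset.mem_union.1 ha with ha | ha
      · have := Finset.min'_le _ _ ha
        have := (Finset.mem_Icc.1 (hA.1 ha)).2
        rw [Finset.mem_Icc]; omega
      · have := Finset.min'_le _ _ ha
        have := (Finset.mem_Icc.1 (hB.1 ha)).2
        rw [Finset.mem_Icc]; omega
    have := Finset.card_le_card sub
    rw [Finset.card_union_of_disjoint hAB.2, hA.2, hB.2, Nat.card_Icc] at this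
    omega

/-! ### Sets decomposed along the three blocks -/

section Blocks

variable {k r : ℕ} {α β γ α' β' γ' : Finset ℕ}

/-- `α`, `β`, `γ` are contained in the blocks `{1, …, k}`, `{k+1, …, 2k-1}`, `{2k, …, 2k+r}`. -/
def InBlocks (k r : ℕ) (α β γ : Finset ℕ) : Prop :=
  α ⊆ Finset.Icc 1 k ∧ β ⊆ Finset.Icc (k + 1) (2 * k - 1) ∧ γ ⊆ Finset.Icc (2 * k) (2 * k + r)

theorem InBlocks.subset_Icc (hk : 1 ≤ k) (h : InBlocks k r α β γ) :
    α ∪ (β ∪ γ) ⊆ Finset.Icc 1 (2 * k + r) := by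
  intro a ha
  simp only [Finset.mem_union] at ha
  rcases ha with ha | ha | ha
  · have := Finset.mem_Icc.1 (h.1 ha); rw [Finset.mem_Icc]; omega
  · have := Finset.mem_Icc.1 (h.2.1 ha); rw [Finset.mem_Icc]; omega
  · have := Finset.mem_Icc.1 (h.2.2 ha); rw [Finset.mem_Icc]; omega

theorem InBlocks.disjoint (hk : 1 ≤ k) (h : InBlocks k r α β γ) (h' : InBlocks k r α' β' γ')
    (hα : Disjoint α α') (hβ : Disjoint β β') (hγ : Disjoint γ γ') :
    Disjoint (α ∪ (β ∪ γ)) (α' ∪ (β' ∪ γ')) := by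
  rw [Finset.disjoint_left] at *
  intro a ha ha'
  simp only [Finset.mem_union] at ha ha'
  rcases ha with ha | ha | ha <;> rcases ha' with ha' | ha' | ha'
  · exact hα ha ha'
  · have := Finset.mem_Icc.1 (h.1 ha); have := Finset.mem_Icc.1 (h'.2.1 ha'); omega
  · have := Finset.mem_Icc.1 (h.1 ha); have := Finset.mem_Icc.1 (h'.2.2 ha'); omega
  · have := Finset.mem_Icc.1 (h.2.1 ha); have := Finset.mem_Icc.1 (h'.1 ha'); omega
  · exact hβ ha ha'
  · have := Finset.mem_Icc.1 (h.2.1 ha); have := Finset.mem_Icc.1 (h'.2.2 ha'); omega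
  · have := Finset.mem_Icc.1 (h.2.2 ha); have := Finset.mem_Icc.1 (h'.1 ha'); omega
  · have := Finset.mem_Icc.1 (h.2.2 ha); have := Finset.mem_Icc.1 (h'.2.1 ha'); omega
  · exact hγ ha ha'

theorem InBlocks.card (hk : 1 ≤ k) (h : InBlocks k r α β γ) :
    (α ∪ (β ∪ γ)).card = α.card + (β.card + γ.card) := by
  rw [Finset.card_union_of_disjoint, Finset.card_union_of_disjoint]
  · rw [Finset.disjoint_left]
    intro a ha ha'
    have := Finset.mem_Icc.1 (h.2.1 ha); have := Finset.mem_Icc.1 (h.2.2 ha'); omega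
  · rw [Finset.disjoint_left]
    intro a ha ha'
    rcases Finset.mem_union.1 ha' with ha' | ha'
    · have := Finset.mem_Icc.1 (h.1 ha); have := Finset.mem_Icc.1 (h.2.1 ha'); omega
    · have := Finset.mem_Icc.1 (h.1 ha); have := Finset.mem_Icc.1 (h.2.2 ha'); omega

theorem InBlocks.subset_of_eq (hk : 1 ≤ k) (h : InBlocks k r α β γ) (h' : InBlocks k r α' β' γ')
    (e : α ∪ (β ∪ γ) = α' ∪ (β' ∪ γ')) : α ⊆ α' ∧ β ⊆ β' ∧ γ ⊆ γ' := by
  have key : ∀ a, a ∈ α ∪ (β ∪ γ) → a ∈ α' ∨ a ∈ β' ∨ a ∈ γ' := fun a ha => by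
    rw [e] at ha; simpa only [Finset.mem_union] using ha
  refine ⟨fun a ha => ?_, fun a ha => ?_, fun a ha => ?_⟩
  · rcases key a (Finset.mem_union_left _ ha) with ha' | ha' | ha'
    · exact ha'
    · have := Finset.mem_Icc.1 (h.1 ha); have := Finset.mem_Icc.1 (h'.2.1 ha'); omega
    · have := Finset.mem_Icc.1 (h.1 ha); have := Finset.mem_Icc.1 (h'.2.2 ha'); omega
  · rcases key a (Finset.mem_union_right _ (Finset.mem_union_left _ ha)) with ha' | ha' | ha'
    · have := Finset.mem_Icc.1 (h.2.1 ha); have := Finset.mem_Icc.1 (h'.1 ha'); omega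
    · exact ha'
    · have := Finset.mem_Icc.1 (h.2.1 ha); have := Finset.mem_Icc.1 (h'.2.2 ha'); omega
  · rcases key a (Finset.mem_union_right _ (Finset.mem_union_right _ ha)) with ha' | ha' | ha'
    · have := Finset.mem_Icc.1 (h.2.2 ha); have := Finset.mem_Icc.1 (h'.1 ha'); omega
    · have := Finset.mem_Icc.1 (h.2.2 ha); have := Finset.mem_Icc.1 (h'.2.1 ha'); omega
    · exact ha'

theorem InBlocks.eq (hk : 1 ≤ k) (h : InBlocks k r α β γ) (h' : InBlocks k r α' β' γ')
    (e : α ∪ (β ∪ γ) = α' ∪ (β' ∪ γ')) : α = α' ∧ β = β' ∧ γ = γ' := by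
  obtain ⟨h1, h2, h3⟩ := h.subset_of_eq hk h' e
  obtain ⟨h4, h5, h6⟩ := h'.subset_of_eq hk h e.symm
  exact ⟨h1.antisymm h4, h2.antisymm h5, h3.antisymm h6⟩

end Blocks

/-! ### Cyclic intervals -/

/-- The `len` cyclically consecutive elements of `{1, …, k}` that start with `i + 1`. -/
def cyclicInterval (k i len : ℕ) : Finset ℕ :=
  (Finset.range len).image fun l => (i + l) % k + 1

theorem cyclicInterval_subset {k : ℕ} (hk : 1 ≤ k) (i len : ℕ) :
    cyclicInterval k i len ⊆ Finset.Icc 1 k := by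
  intro a ha
  obtain ⟨l, -, rfl⟩ := Finset.mem_image.1 ha
  have := Nat.mod_lt (i + l) hk
  rw [Finset.mem_Icc]; omega

theorem cyclicInterval_mono (k i : ℕ) {len len' : ℕ} (h : len ≤ len') :
    cyclicInterval k i len ⊆ cyclicInterval k i len' :=
  Finset.image_subset_image (Finset.range_subset_range.2 h)

theorem card_cyclicInterval {k i len : ℕ} (h : len ≤ k) : (cyclicInterval k i len).card = len := by
  rw [cyclicInterval, Finset.card_image_of_injOn, Finset.card_range]
  intro l hl l' hl' e
  rw [Finset.mem_coe, Finset.mem_range] at hl hl'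
  have e' : i + l ≡ i + l' [MOD k] := Nat.succ_injective e
  exact (Nat.ModEq.add_left_cancel' i e').eq_of_lt_of_lt (by omega) (by omega)

/-- A proper nonempty cyclic interval determines its starting point. -/
theorem cyclicInterval_injective {k i i' len : ℕ} (hi : i < k) (hi' : i' < k) (h0 : 0 < len)
    (hlen : len < k) (h : cyclicInterval k i len = cyclicInterval k i' len) : i = i' := by
  have h1 : i' % k + 1 ∈ cyclicInterval k i len := by
    rw [h]; exact Finset.mem_image.2 ⟨0, by simpa using h0, rfl⟩
  obtain ⟨l, hl, e⟩ := Finset.mem_image.1 h1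
  rw [Finset.mem_range] at hl
  have e1 : i + l ≡ i' [MOD k] := Nat.succ_injective e
  rcases Nat.eq_zero_or_pos l with rfl | hl0
  · exact e1.eq_of_lt_of_lt hi hi'
  -- If the start of the second interval is not the start of the first, its cyclic predecessor also
  -- lies in the common set. An interval of length less than k never contains the predecessor of its
  -- start.
  · have h2 : (i + (l - 1)) % k + 1 ∈ cyclicInterval k i' len := by
      rw [← h]; exact Finset.mem_image.2 ⟨l - 1, by rw [Finset.mem_range]; omega, rfl⟩
    obtain ⟨l', hl', e'⟩ := Finset.mem_image.1 h2
    rw [Finset.mem_range] at hl'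
    have e2 : i' + l' ≡ i + (l - 1) [MOD k] := Nat.succ_injective e'
    have e3 : i' + (l' + 1) ≡ i' + 0 [MOD k] := by
      have h3 := e2.add_right 1
      rw [show i + (l - 1) + 1 = i + l by omega, add_assoc] at h3
      exact h3.trans e1
    have := (Nat.ModEq.add_left_cancel' i' e3).eq_of_lt_of_lt (by omega) (by omega)
    omega

/-! ### Terminals, and long paths for r < k -/

/-- The terminals `{k+1, …, 2k-1} ∪ {2k+i}`. -/
def starTerminal (k i : ℕ) : Finset ℕ := ∅ ∪ (Finset.Icc (k + 1) (2 * k - 1) ∪ {2 * k + i})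

theorem inBlocks_starTerminal {k r i : ℕ} (hi : i ≤ r) :
    InBlocks k r ∅ (Finset.Icc (k + 1) (2 * k - 1)) {2 * k + i} := by
  refine ⟨by simp, subset_rfl, ?_⟩
  rw [Finset.singleton_subset_iff, Finset.mem_Icc]
  omega

theorem card_starTerminal {k i : ℕ} (hk : 1 ≤ k) : (starTerminal k i).card = k := by
  rw [starTerminal, (inBlocks_starTerminal le_rfl).card hk]
  simp only [Finset.card_empty, Nat.card_Icc, Finset.card_singleton]
  omega

theorem starTerminal_subset {k r i : ℕ} (hk : 1 ≤ k) (hi : i ≤ r) :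
    starTerminal k i ⊆ Finset.Icc (k + 1) (2 * k + r) := by
  intro a ha
  simp only [starTerminal, Finset.mem_union, Finset.notMem_empty, false_or,
    Finset.mem_singleton, Finset.mem_Icc] at ha
  rw [Finset.mem_Icc]
  omega

theorem starTerminal_injective {k i j : ℕ} (hk : 1 ≤ k) (h : starTerminal k i = starTerminal k j) :
    i = j := by
  have := ((inBlocks_starTerminal (le_max_left i j)).eq hk
    (inBlocks_starTerminal (le_max_right i j)) h).2.2
  have := Finset.singleton_injective this
  omega

/-- The vertices at odd positions of the path from `X_i` to `X_j` for `r < k`. -/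
def oddVertex (k r i j s : ℕ) : Finset ℕ :=
  (Finset.Icc 1 k \ cyclicInterval k i (min (s * r + 1) k)) ∪
    (Finset.Icc (k + 1) (min (k + s * r) (2 * k - 1)) ∪ {2 * k + j})

/-- The vertices at positive even positions of the path from `X_i` to `X_j` for `r < k`. -/
def evenVertex (k r i j s : ℕ) : Finset ℕ :=
  cyclicInterval k i (min ((s - 1) * r + 1) (k - r)) ∪
    (Finset.Icc (min (k + s * r) (2 * k - 1) + 1) (2 * k - 1) ∪
      (Finset.Icc (2 * k) (2 * k + r)).erase (2 * k + j))

/-- The path from `X_i` to `X_j` for `r < k`. -/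
def pathVertex (k r i j t : ℕ) : Finset ℕ :=
  if t = 0 then starTerminal k i
  else if t % 2 = 1 then oddVertex k r i j (t / 2) else evenVertex k r i j (t / 2)

section LongPaths

variable {k r : ℕ}

theorem inBlocks_oddVertex {i j s : ℕ} (hj : j ≤ r) :
    InBlocks k r (Finset.Icc 1 k \ cyclicInterval k i (min (s * r + 1) k))
      (Finset.Icc (k + 1) (min (k + s * r) (2 * k - 1))) {2 * k + j} := by
  refine ⟨Finset.sdiff_subset, Finset.Icc_subset_Icc_right (by omega), ?_⟩
  rw [Finset.singleton_subset_iff, Finset.mem_Icc]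
  omega

theorem inBlocks_evenVertex (hk : 1 ≤ k) {i j s : ℕ} :
    InBlocks k r (cyclicInterval k i (min ((s - 1) * r + 1) (k - r)))
      (Finset.Icc (min (k + s * r) (2 * k - 1) + 1) (2 * k - 1))
      ((Finset.Icc (2 * k) (2 * k + r)).erase (2 * k + j)) :=
  ⟨cyclicInterval_subset hk _ _, Finset.Icc_subset_Icc_left (by omega), Finset.erase_subset _ _⟩

/-- Points lost in the first block are gained in the middle one. Both truncations are reached
together, at sr = k - 1. -/
theorem card_oddVertex (hk : 1 ≤ k) {i j s : ℕ} (hj : j ≤ r) : (oddVertex k r i j s).card = k := by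
  rw [oddVertex, (inBlocks_oddVertex hj).card hk,
    Finset.card_sdiff_of_subset (cyclicInterval_subset hk _ _),
    card_cyclicInterval (min_le_right _ _)]
  simp only [Nat.card_Icc, Finset.card_singleton]
  omega

/-- The last block contributes r points. The cap k - r on the cyclic interval is reached exactly
when sr ≥ k - 1, that is, when the middle part is empty. -/
theorem card_evenVertex (hrk : r < k) {i j s : ℕ} (hj : j ≤ r) (hs : 1 ≤ s) :
    (evenVertex k r i j s).card = k := by
  have hC : 2 * k + j ∈ Finset.Icc (2 * k) (2 * k + r) := by rw [Finset.mem_Icc]; omega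
  rw [evenVertex, (inBlocks_evenVertex (by omega)).card (by omega),
    card_cyclicInterval ((min_le_right _ _).trans (Nat.sub_le _ _)), Finset.card_erase_of_mem hC]
  simp only [Nat.card_Icc]
  obtain ⟨s, rfl⟩ := Nat.exists_eq_add_of_le' hs
  rw [Nat.add_sub_cancel, Nat.add_mul, one_mul]
  omega

theorem disjoint_starTerminal_oddVertex (hk : 1 ≤ k) {i j : ℕ} (hi : i ≤ r) (hj : j ≤ r)
    (hij : i ≠ j) : Disjoint (starTerminal k i) (oddVertex k r i j 0) := by
  refine (inBlocks_starTerminal hi).disjoint hk (inBlocks_oddVertex hj) (by simp) ?_ ?_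
  · rw [Finset.Icc_eq_empty (a := k + 1) (b := min (k + 0 * r) (2 * k - 1)) (by omega)]
    simp
  · simp; omega

/-- The cases s' = s and s' = s + 1 are the two even neighbours of an odd position. In both, the
interval has length at most sr + 1, so it lies in the one removed from the odd vertex, and the
middle part starts beyond the first sr points. -/
theorem disjoint_oddVertex_evenVertex (hk : 1 ≤ k) {i j s s' : ℕ} (hj : j ≤ r) (hs : s ≤ s')
    (hs' : s' ≤ s + 1) : Disjoint (oddVertex k r i j s) (evenVertex k r i j s') := by
  refine (inBlocks_oddVertex hj).disjoint hk (inBlocks_evenVertex hk) ?_ ?_ ?_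
  · refine Finset.disjoint_of_subset_right (cyclicInterval_mono k i ?_) Finset.sdiff_disjoint
    have : (s' - 1) * r ≤ s * r := Nat.mul_le_mul_right _ (by omega)
    omega
  · have : s * r ≤ s' * r := Nat.mul_le_mul_right _ hs
    rw [Finset.disjoint_left]
    intro a
    simp only [Finset.mem_Icc]
    omega
  · simp

theorem oddVertex_last (hk : 1 ≤ k) {i j m : ℕ} (hm : k - 1 ≤ m * r) :
    oddVertex k r i j m = starTerminal k j := by
  have h1 : Finset.Icc 1 k \ cyclicInterval k i (min (m * r + 1) k) = ∅ := by
    rw [min_eq_right (by omega), Finset.sdiff_eq_empty_iff_subset]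
    refine (Finset.eq_of_subset_of_card_le (cyclicInterval_subset hk _ _) ?_).ge
    rw [card_cyclicInterval le_rfl]; simp
  rw [oddVertex, starTerminal, h1, min_eq_right (by omega)]

theorem pathVertex_odd (i j s : ℕ) : pathVertex k r i j (2 * s + 1) = oddVertex k r i j s := by
  rw [pathVertex, if_neg (by omega), if_pos (by omega), show (2 * s + 1) / 2 = s by omega]

theorem pathVertex_even (i j : ℕ) {s : ℕ} (hs : 1 ≤ s) :
    pathVertex k r i j (2 * s) = evenVertex k r i j s := by
  rw [pathVertex, if_neg (by omega), if_neg (by omega), show 2 * s / 2 = s by omega]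

/-- For r ≥ 1 the hypothesis says m = ⌈(k-1)/r⌉. The first inequality makes the path end at X_j; the
second keeps the truncation from taking effect too early, so that internal vertices differ from the
terminals and from one another. For r = 0 there is no pair X_i, X_j to join. -/
theorem exists_standardForm_of_lt {m : ℕ} (hrk : r < k)
    (hm : 1 ≤ r → k - 1 ≤ m * r ∧ (m - 1) * r < k - 1) :
    ∃ S : GraphSubdivision (⊤ : SimpleGraph (Fin (r + 2))) (kneserGraph (2 * k + r) k),
      S.IsTotallyOdd ∧ HasStandardForm k r (2 * m + 1) S := by
  have hk : 1 ≤ k := by omega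
  have odd_or_even : ∀ t, 0 < t → t < 2 * m + 1 → (∃ s, s < m ∧ t = 2 * s + 1) ∨
      ∃ s, 1 ≤ s ∧ s ≤ m ∧ t = 2 * s := by
    intro t h0 ht
    rcases Nat.even_or_odd' t with ⟨s, rfl | rfl⟩
    · exact .inr ⟨s, by omega, by omega, rfl⟩
    · exact .inl ⟨s, by omega, rfl⟩
  have hmul : ∀ s, s < m → s * r ≤ (m - 1) * r := fun s hs => Nat.mul_le_mul_right _ (by omega)
  have hstrict : 1 ≤ r → ∀ s s', s < s' → s * r < s' * r :=
    fun hr s s' h => Nat.mul_lt_mul_of_pos_right h hr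
  refine Exists.elim (exists_subdivision_kneserGraph (r := r) hk (starTerminal k)
    (fun _ _ => 2 * m + 1) (pathVertex k r)
    (fun i hi => ⟨starTerminal_subset hk hi, card_starTerminal hk⟩)
    (fun i _ j _ h => starTerminal_injective hk h)
    (fun i j _ _ => if_pos rfl)
    (fun i j hij hj => (pathVertex_odd i j m).trans (oddVertex_last hk (hm (by omega)).1))
    ?_ ?_ ?_ ?_) ?_
  rotate_left 4
  · rintro S ⟨h0, h1, h2, h3, h4, h5⟩
    have hl : ∀ i j h, (S.path (Fin.succ i) (Fin.succ j) h).length = 2 * m + 1 := by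
      intro i j h
      rcases lt_or_gt_of_ne (Fin.succ_injective _ |>.ne_iff.1 h.ne) with hij | hij
      · exact h4 i j h hij
      · exact h5 i j h hij
    refine ⟨S, ?_, h0, fun i => (h1 i).trans (Finset.empty_union _), h2, hl⟩
    intro u v h
    cases u using Fin.cases with
    | zero =>
      cases v using Fin.cases with
      | zero => exact (h.ne rfl).elim
      | succ j => rw [h2]; exact odd_one
    | succ i =>
      cases v using Fin.cases with
      | zero => rw [h3]; exact odd_one
      | succ j => rw [hl]; exact odd_two_mul_add_one m
  · intro i j hij hj t ht
    rcases Nat.even_or_odd' t with ⟨s, rfl | rfl⟩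
    · rcases Nat.eq_zero_or_pos s with rfl | hs
      · exact ⟨(inBlocks_starTerminal (by omega)).subset_Icc hk, card_starTerminal hk⟩
      · rw [pathVertex_even i j hs]
        exact ⟨(inBlocks_evenVertex hk).subset_Icc hk, card_evenVertex hrk hj hs⟩
    · rw [pathVertex_odd]
      exact ⟨(inBlocks_oddVertex hj).subset_Icc hk, card_oddVertex hk hj⟩
  · intro i j hij hj t ht
    rcases Nat.even_or_odd' t with ⟨s, rfl | rfl⟩
    · rw [pathVertex_odd]
      rcases Nat.eq_zero_or_pos s with rfl | hs
      · exact disjoint_starTerminal_oddVertex hk (by omega) hj hij.ne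
      · rw [pathVertex_even i j hs]
        exact (disjoint_oddVertex_evenVertex hk hj le_rfl (by omega)).symm
    · rw [pathVertex_odd, show 2 * s + 1 + 1 = 2 * (s + 1) by ring,
        pathVertex_even i j (by omega)]
      exact disjoint_oddVertex_evenVertex hk hj (by omega) le_rfl
  · intro i j hij hj t ht0 ht
    have hr : 1 ≤ r := by omega
    obtain ⟨hm1, hm2⟩ := hm hr
    have hY : InBlocks k r (Finset.Icc 1 k) ∅ ∅ := ⟨subset_rfl, by simp, by simp⟩
    have eY : Finset.Icc 1 k = Finset.Icc 1 k ∪ ((∅ : Finset ℕ) ∪ ∅) := by simp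
    rcases odd_or_even t ht0 ht with ⟨s, hs, rfl⟩ | ⟨s, hs1, hs, rfl⟩
    · rw [pathVertex_odd]
      refine ⟨fun e => ?_, fun l hl e => ?_⟩
      · rw [eY] at e
        exact Finset.singleton_ne_empty _ ((inBlocks_oddVertex hj).eq hk hY e).2.2
      · have := congrArg Finset.card ((inBlocks_oddVertex hj).eq hk (inBlocks_starTerminal hl) e).1
        rw [Finset.card_sdiff_of_subset (cyclicInterval_subset hk _ _),
          card_cyclicInterval (min_le_right _ _)] at this
        simp only [Nat.card_Icc, Finset.card_empty] at this
        have := hmul s hs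
        omega
    · rw [pathVertex_even i j hs1]
      refine ⟨fun e => ?_, fun l hl e => ?_⟩
      · rw [eY] at e
        have := congrArg Finset.card ((inBlocks_evenVertex hk).eq hk hY e).1
        rw [card_cyclicInterval ((min_le_right _ _).trans (Nat.sub_le _ _))] at this
        simp only [Nat.card_Icc] at this
        omega
      · have := congrArg Finset.card ((inBlocks_evenVertex hk).eq hk (inBlocks_starTerminal hl) e).1
        rw [card_cyclicInterval ((min_le_right _ _).trans (Nat.sub_le _ _))] at this
        simp only [Finset.card_empty] at this
        omega
  · intro i j i' j' t t' hij hj hij' hj' ht0 ht ht0' ht' e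
    have hr : 1 ≤ r := by omega
    obtain ⟨hm1, hm2⟩ := hm hr
    -- The last block has one point in an odd vertex and r in an even one. If r = 1, then j = j' =
    -- 1, and the odd vertex contains 2k+1 while the even one omits it.
    have cross : ∀ {i j i' j' s s'}, i < j → j ≤ r → i' < j' → j' ≤ r →
        oddVertex k r i j s ≠ evenVertex k r i' j' s' := by
      intro i j i' j' s s' hij hj hij' hj' e
      have e := ((inBlocks_oddVertex hj).eq hk (inBlocks_evenVertex hk) e).2.2
      have hC : 2 * k + j' ∈ Finset.Icc (2 * k) (2 * k + r) := by rw [Finset.mem_Icc]; omega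
      have hc := congrArg Finset.card e
      rw [Finset.card_erase_of_mem hC] at hc
      simp only [Nat.card_Icc, Finset.card_singleton] at hc
      have hm := e.le (Finset.mem_singleton_self _)
      rw [Finset.mem_erase] at hm
      omega
    rcases odd_or_even t ht0 ht with ⟨s, hs, rfl⟩ | ⟨s, hs1, hs, rfl⟩ <;>
      rcases odd_or_even t' ht0' ht' with ⟨s', hs', rfl⟩ | ⟨s', hs1', hs', rfl⟩
    · rw [pathVertex_odd, pathVertex_odd] at e
      obtain ⟨e1, e2, e3⟩ := (inBlocks_oddVertex hj).eq hk (inBlocks_oddVertex hj') e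
      have hss : s = s' := by
        have hc := congrArg Finset.card e2
        simp only [Nat.card_Icc] at hc
        have := hmul s hs
        have := hmul s' hs'
        rcases lt_trichotomy s s' with h | h | h
        · have := hstrict hr _ _ h; omega
        · exact h
        · have := hstrict hr _ _ h; omega
      subst hss
      have hjj := Finset.singleton_injective e3
      -- Complementing in {1..k} recovers the cyclic interval, whose start is i + 1.
      have e1' := congrArg (Finset.Icc 1 k \ ·) e1
      simp only [Finset.sdiff_sdiff_eq_self (cyclicInterval_subset hk _ _)] at e1'
      have := hmul s hs
      exact ⟨cyclicInterval_injective (by omega) (by omega) (by omega) (by omega) e1',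
        by omega, rfl⟩
    · rw [pathVertex_odd, pathVertex_even _ _ hs1'] at e
      exact (cross hij hj hij' hj' e).elim
    · rw [pathVertex_odd, pathVertex_even _ _ hs1] at e
      exact (cross hij' hj' hij hj e.symm).elim
    · rw [pathVertex_even _ _ hs1, pathVertex_even _ _ hs1'] at e
      obtain ⟨e1, e2, e3⟩ := (inBlocks_evenVertex hk).eq hk (inBlocks_evenVertex hk) e
      -- Even positions include s = m, where the middle part is empty; for s < m it is nonempty, so
      -- its size still determines s.
      have bound : ∀ s, s < m → s * r < k - 1 := fun s hs => (hmul s hs).trans_lt hm2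
      have hss : s = s' := by
        have hc := congrArg Finset.card e2
        simp only [Nat.card_Icc] at hc
        rcases lt_trichotomy s s' with h | h | h
        · have := hstrict hr _ _ h; have := bound s (by omega); omega
        · exact h
        · have := hstrict hr _ _ h; have := bound s' (by omega); omega
      subst hss
      have hjj : j = j' := by
        by_contra hne
        have : 2 * k + j' ∈ (Finset.Icc (2 * k) (2 * k + r)).erase (2 * k + j) := by
          rw [Finset.mem_erase, Finset.mem_Icc]; omega
        rw [e3] at this
        simp at this
      exact ⟨cyclicInterval_injective (by omega) (by omega) (by omega) (by omega) e1, hjj, rfl⟩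

end LongPaths

/-! ### Distinct sets avoiding pairs, by Hall's theorem -/

/-- For `2 ≤ d ≤ N - 2` there is an injective assignment of disjoint `d`-element subsets to the
two-element subsets of an `N`-element set. -/
theorem exists_injective_disjoint_powersetCard {N d : ℕ} (hd : 2 ≤ d) (hN : d + 2 ≤ N) :
    ∃ f : {e // e ∈ Finset.powersetCard 2 (Finset.range N)} → Finset ℕ, Function.Injective f ∧
      ∀ e, f e ∈ Finset.powersetCard d (Finset.range N \ e.1) := by
  classical
  rw [← Finset.all_card_le_biUnion_card_iff_exists_injective
    fun e : {e // e ∈ Finset.powersetCard 2 (Finset.range N)} =>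
      Finset.powersetCard d (Finset.range N \ e.1)]
  intro s
  set U := s.biUnion fun e => Finset.powersetCard d (Finset.range N \ e.1) with hU
  -- By symmetry both sides are binomial coefficients with lower index N - 2 - d, and N - d ≤ N - 2
  -- because d ≥ 2.
  have hle : (N - d).choose 2 ≤ (N - 2).choose d := by
    have h1 : (N - 2).choose d = (N - 2).choose (N - 2 - d) :=
      (Nat.choose_symm (by omega)).symm
    have h2 : (N - d).choose 2 = (N - d).choose (N - 2 - d) := by
      rw [← Nat.choose_symm (by omega : 2 ≤ N - d)]
      congr 1
      omega
    rw [h1, h2]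
    exact Nat.choose_le_choose _ (by omega)
  have hpos : 0 < (N - 2).choose d := Nat.choose_pos (by omega)
  -- Hall's condition by double counting: each pair is disjoint from (N-2 choose d) of the d-sets,
  -- and each d-set from at most (N-d choose 2) of the pairs.
  have main := Finset.card_mul_le_card_mul (s := s) (t := U)
    (fun e T => T ∈ Finset.powersetCard d (Finset.range N \ e.1))
    (m := (N - 2).choose d) (n := (N - d).choose 2) ?_ ?_
  · exact Nat.le_of_mul_le_mul_right (main.trans (Nat.mul_le_mul_left _ hle)) hpos
  · intro e he
    have h2 := Finset.mem_powersetCard.1 e.2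
    have hc : (Finset.powersetCard d (Finset.range N \ e.1)).card = (N - 2).choose d := by
      rw [Finset.card_powersetCard, Finset.card_sdiff_of_subset h2.1, h2.2, Finset.card_range]
    rw [← hc]
    refine Finset.card_le_card fun T hT => ?_
    rw [Finset.mem_bipartiteAbove]
    exact ⟨Finset.mem_biUnion.2 ⟨e, he, hT⟩, hT⟩
  · intro T hT
    obtain ⟨e₀, -, hT⟩ := Finset.mem_biUnion.1 hT
    rw [Finset.mem_powersetCard] at hT
    have hTN : T ⊆ Finset.range N := hT.1.trans Finset.sdiff_subset
    have hc : (Finset.powersetCard 2 (Finset.range N \ T)).card = (N - d).choose 2 := by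
      rw [Finset.card_powersetCard, Finset.card_sdiff_of_subset hTN, hT.2, Finset.card_range]
    rw [← hc]
    refine Finset.card_le_card_of_injOn Subtype.val (fun e he => ?_) Subtype.val_injective.injOn
    have he := (Finset.mem_bipartiteBelow _).1 he
    have h2 := Finset.mem_powersetCard.1 e.2
    have h3 := Finset.mem_powersetCard.1 he.2
    rw [Finset.mem_coe, Finset.mem_powersetCard]
    refine ⟨fun a ha => Finset.mem_sdiff.2 ⟨h2.1 ha, fun haT => ?_⟩, h2.2⟩
    exact (Finset.mem_sdiff.1 (h3.1 haT)).2 ha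

theorem exists_injective_avoiding {N d : ℕ} (hd : 2 ≤ d) (hN : d + 2 ≤ N) :
    ∃ T : ℕ → ℕ → Finset ℕ,
      (∀ p q, p < q → q < N → T p q ⊆ Finset.range N ∧ (T p q).card = d ∧ q ∉ T p q ∧
        p ∉ T p q) ∧
      ∀ p q p' q', p < q → q < N → p' < q' → q' < N → T p q = T p' q' → p = p' ∧ q = q' := by
  obtain ⟨f, hf, hfm⟩ := exists_injective_disjoint_powersetCard hd hN
  have hpq : ∀ p q, p < q → q < N →
      ({p, q} : Finset ℕ) ∈ Finset.powersetCard 2 (Finset.range N) := by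
    intro p q h h'
    rw [Finset.mem_powersetCard]
    refine ⟨?_, Finset.card_pair h.ne⟩
    intro a ha
    simp only [Finset.mem_insert, Finset.mem_singleton] at ha
    rw [Finset.mem_range]; omega
  have hT : ∀ p q (h : p < q) (h' : q < N),
      (fun p q => if h : p < q ∧ q < N then f ⟨_, hpq p q h.1 h.2⟩ else ∅) p q
        = f ⟨_, hpq p q h h'⟩ := fun p q h h' => dif_pos ⟨h, h'⟩
  refine ⟨fun p q => if h : p < q ∧ q < N then f ⟨_, hpq p q h.1 h.2⟩ else ∅, ?_, ?_⟩
  · intro p q h h'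
    rw [hT p q h h']
    have := Finset.mem_powersetCard.1 (hfm ⟨_, hpq p q h h'⟩)
    refine ⟨this.1.trans Finset.sdiff_subset, this.2, fun hm => ?_, fun hm => ?_⟩
    · exact (Finset.mem_sdiff.1 (this.1 hm)).2 (by simp)
    · exact (Finset.mem_sdiff.1 (this.1 hm)).2 (by simp)
  · intro p q p' q' h1 h2 h1' h2' e
    rw [hT p q h1 h2, hT p' q' h1' h2'] at e
    have e := congrArg Subtype.val (hf e)
    simp only at e
    have m1 : p ∈ ({p', q'} : Finset ℕ) := by rw [← e]; simp
    have m2 : q ∈ ({p', q'} : Finset ℕ) := by rw [← e]; simp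
    simp only [Finset.mem_insert, Finset.mem_singleton] at m1 m2
    omega

/-! ### Paths of length 3 for r ≥ k ≥ 3 -/

section ShortPaths

variable {k r : ℕ}

/-- The part in `{1, …, k}` of the neighbour of `X_i` on the path from `X_i` to `X_j`, `i < j`. -/
def firstLeft (k i : ℕ) : Finset ℕ :=
  if i = 0 then (Finset.Icc 1 k).erase 3 else ((Finset.Icc 1 k).erase 3).erase 2

/-- The part in `{2k, …, 2k+r}` of the neighbour of `X_i` on the path from `X_i` to `X_j`. -/
def firstRight (k i j : ℕ) : Finset ℕ :=
  if i = 0 then {2 * k + j} else {2 * k + (i - 1), 2 * k + j}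

/-- The part in `{1, …, k}` of the neighbour of `X_j` on the path from `X_i` to `X_j`, `i < j`. -/
def secondLeft (i : ℕ) : Finset ℕ := if i = 0 then {3} else {2}

theorem inBlocks_first {i j : ℕ} (hij : i < j) (hj : j ≤ r) :
    InBlocks k r (firstLeft k i) ∅ (firstRight k i j) := by
  refine ⟨?_, by simp, ?_⟩
  · rw [firstLeft]
    split_ifs
    · exact Finset.erase_subset _ _
    · exact (Finset.erase_subset _ _).trans (Finset.erase_subset _ _)
  · intro a ha
    rw [firstRight] at ha
    rw [Finset.mem_Icc]
    split_ifs at ha <;> simp only [Finset.mem_insert, Finset.mem_singleton] at ha <;> omega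

theorem card_first (hk : 3 ≤ k) {i j : ℕ} (hij : i < j) (hj : j ≤ r) :
    (firstLeft k i ∪ (∅ ∪ firstRight k i j)).card = k := by
  rw [(inBlocks_first hij hj).card (by omega), firstLeft, firstRight]
  have h3 : 3 ∈ Finset.Icc 1 k := by rw [Finset.mem_Icc]; omega
  have h2 : 2 ∈ (Finset.Icc 1 k).erase 3 := by simp; omega
  split_ifs
  · rw [Finset.card_erase_of_mem h3, Finset.card_singleton]
    simp; omega
  · rw [Finset.card_erase_of_mem h2, Finset.card_erase_of_mem h3, Finset.card_pair (by omega)]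
    simp; omega

/-- The neighbour of X_i must avoid 2k+i, so it records i ≥ 1 by the point 2k+(i-1) and i = 0 by
keeping the point 2. The neighbour of X_j uses a (k-1)-set that avoids the points i-1 and j. With
truncated subtraction i = 0 and i = 1 give the same pair; the point 3 or 2 of `secondLeft` tells
them apart. -/
theorem exists_standardForm_of_ge (hk : 3 ≤ k) (hkr : k ≤ r) :
    ∃ S : GraphSubdivision (⊤ : SimpleGraph (Fin (r + 2))) (kneserGraph (2 * k + r) k),
      HasStandardForm k r 3 S ∧ ∀ u v h, (S.path u v h).length = 1 ∨ (S.path u v h).length = 3 := by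
  have hk1 : 1 ≤ k := by omega
  -- The condition d + 2 ≤ N is exactly k ≤ r, and d ≥ 2 is k ≥ 3.
  obtain ⟨T, hT, hTinj⟩ := exists_injective_avoiding (N := r + 1) (d := k - 1) (by omega) (by omega)
  let g : ℕ → ℕ → Finset ℕ := fun i j => (T (i - 1) j).map (addLeftEmbedding (2 * k))
  have hg : ∀ i j a, a ∈ g i j ↔ ∃ b ∈ T (i - 1) j, 2 * k + b = a := fun i j a => by
    simp [g]
  have inBlocks_second : ∀ i j, i < j → j ≤ r → InBlocks k r (secondLeft i) ∅ (g i j) := by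
    intro i j hij hj
    refine ⟨?_, by simp, ?_⟩
    · intro a ha
      rw [secondLeft] at ha
      rw [Finset.mem_Icc]
      split_ifs at ha <;> simp only [Finset.mem_singleton] at ha <;> omega
    · intro a ha
      obtain ⟨b, hb, rfl⟩ := (hg i j a).1 ha
      have := Finset.mem_range.1 ((hT (i - 1) j (by omega) (by omega)).1 hb)
      rw [Finset.mem_Icc]; omega
  have card_second : ∀ i j, i < j → j ≤ r → (secondLeft i ∪ (∅ ∪ g i j)).card = k := by
    intro i j hij hj
    rw [(inBlocks_second i j hij hj).card hk1, Finset.card_map,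
      (hT (i - 1) j (by omega) (by omega)).2.1, secondLeft]
    split_ifs <;> simp <;> omega
  have three : ∀ t, 0 < t → t < 3 → t = 1 ∨ t = 2 := fun t _ _ => by omega
  -- The point 1 belongs to every first internal vertex and to no second one.
  have sep : ∀ i i', firstLeft k i ≠ secondLeft i' := by
    intro i i' e
    have h1 : 1 ∈ firstLeft k i := by rw [firstLeft]; split_ifs <;> simp <;> omega
    rw [e, secondLeft] at h1
    split_ifs at h1 <;> simp at h1
  have Y_ne : ∀ {α γ : Finset ℕ}, InBlocks k r α ∅ γ → γ.Nonempty →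
      α ∪ (∅ ∪ γ) ≠ Finset.Icc 1 k := by
    intro α γ h hγ e
    have hY : InBlocks k r (Finset.Icc 1 k) ∅ ∅ := ⟨subset_rfl, by simp, by simp⟩
    have := (h.eq hk1 hY (e.trans (by simp))).2.2
    exact hγ.ne_empty this
  have X_ne : ∀ {α γ : Finset ℕ}, InBlocks k r α ∅ γ → ∀ l ≤ r,
      α ∪ (∅ ∪ γ) ≠ starTerminal k l := by
    intro α γ h l hl e
    have := congrArg Finset.card (h.eq hk1 (inBlocks_starTerminal hl) e).2.1
    simp only [Finset.card_empty, Nat.card_Icc] at this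
    omega
  refine Exists.elim (exists_subdivision_kneserGraph (r := r) hk1 (starTerminal k) (fun _ _ => 3)
    (fun i j t => if t = 0 then starTerminal k i else
      if t = 1 then firstLeft k i ∪ (∅ ∪ firstRight k i j) else
      if t = 2 then secondLeft i ∪ (∅ ∪ g i j) else starTerminal k j)
    (fun i hi => ⟨starTerminal_subset hk1 hi, card_starTerminal hk1⟩)
    (fun i _ j _ h => starTerminal_injective hk1 h)
    (fun i j _ _ => if_pos rfl) (fun i j _ _ => rfl) ?_ ?_ ?_ ?_) ?_
  rotate_left 4
  · rintro S ⟨h0, h1, h2, h3, h4, h5⟩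
    have hl : ∀ i j h, (S.path (Fin.succ i) (Fin.succ j) h).length = 3 := by
      intro i j h
      rcases lt_or_gt_of_ne (Fin.succ_injective _ |>.ne_iff.1 h.ne) with hij | hij
      · exact h4 i j h hij
      · exact h5 i j h hij
    refine ⟨S, ⟨h0, fun i => (h1 i).trans (Finset.empty_union _), h2, hl⟩, ?_⟩
    intro u v h
    cases u using Fin.cases with
    | zero =>
      cases v using Fin.cases with
      | zero => exact (h.ne rfl).elim
      | succ j => exact .inl (h2 _ _)
    | succ i =>
      cases v using Fin.cases with
      | zero => exact .inl (h3 _ _)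
      | succ j => exact .inr (hl _ _ _)
  · intro i j hij hj t ht
    split_ifs
    · exact ⟨(inBlocks_starTerminal (by omega)).subset_Icc hk1, card_starTerminal hk1⟩
    · exact ⟨(inBlocks_first hij hj).subset_Icc hk1, card_first hk hij hj⟩
    · exact ⟨(inBlocks_second i j hij hj).subset_Icc hk1, card_second i j hij hj⟩
    · exact ⟨(inBlocks_starTerminal (by omega)).subset_Icc hk1, card_starTerminal hk1⟩
  · intro i j hij hj t ht
    obtain ⟨hT1, hT2, hT3, hT4⟩ := hT (i - 1) j (by omega) (by omega)
    interval_cases t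
    · simp only [if_true, zero_add, one_ne_zero, if_false]
      refine (inBlocks_starTerminal (by omega)).disjoint hk1 (inBlocks_first hij hj) (by simp)
        (by simp) ?_
      rw [Finset.disjoint_singleton_left, firstRight]
      split_ifs <;> simp <;> omega
    · change Disjoint (firstLeft k i ∪ (∅ ∪ firstRight k i j)) (secondLeft i ∪ (∅ ∪ g i j))
      refine (inBlocks_first hij hj).disjoint hk1 (inBlocks_second i j hij hj) ?_ (by simp) ?_
      · rw [firstLeft, secondLeft]
        split_ifs <;> simp
      · rw [Finset.disjoint_left]
        intro a ha ha'
        obtain ⟨b, hb, rfl⟩ := (hg i j a).1 ha'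
        have hbj : b ≠ j := by rintro rfl; exact hT3 hb
        have hbi : b ≠ i - 1 := by rintro rfl; exact hT4 hb
        rw [firstRight] at ha
        split_ifs at ha <;> simp only [Finset.mem_insert, Finset.mem_singleton] at ha <;> omega
    · change Disjoint (secondLeft i ∪ (∅ ∪ g i j)) (starTerminal k j)
      refine (inBlocks_second i j hij hj).disjoint hk1 (inBlocks_starTerminal hj) (by simp)
        (by simp) ?_
      rw [Finset.disjoint_singleton_right, hg]
      rintro ⟨b, hb, e⟩
      obtain rfl : b = j := by omega
      exact hT3 hb
  · intro i j hij hj t ht0 ht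
    rcases three t ht0 ht with rfl | rfl
    · refine ⟨Y_ne (inBlocks_first hij hj) ⟨2 * k + j, ?_⟩, X_ne (inBlocks_first hij hj)⟩
      rw [firstRight]; split_ifs <;> simp
    · refine ⟨Y_ne (inBlocks_second i j hij hj) ?_, X_ne (inBlocks_second i j hij hj)⟩
      rw [← Finset.card_pos, Finset.card_map, (hT (i - 1) j (by omega) (by omega)).2.1]
      omega
  · intro i j i' j' t t' hij hj hij' hj' ht0 ht ht0' ht' e
    rcases three t ht0 ht with rfl | rfl <;> rcases three t' ht0' ht' with rfl | rfl
    · obtain ⟨e1, -, e3⟩ := (inBlocks_first hij hj).eq hk1 (inBlocks_first hij' hj') e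
      have hi : i = 0 ↔ i' = 0 := by
        have h2 : ∀ i, 2 ∈ firstLeft k i ↔ i = 0 := by
          intro i
          rw [firstLeft]; split_ifs with h <;> simp [h]
          omega
        rw [← h2, ← h2, e1]
      have m1 : ∀ a, a ∈ firstRight k i j ↔ a ∈ firstRight k i' j' := fun a => by rw [e3]
      have hm : ∀ i j a, a ∈ firstRight k i j ↔ a = 2 * k + j ∨ (i ≠ 0 ∧ a = 2 * k + (i - 1)) := by
        intro i j a
        rw [firstRight]
        split_ifs with h <;> simp [h, or_comm]
      simp only [hm] at m1
      -- Since i - 1 < j, the pair of points in the last block is ordered and determines i and j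
      -- when i ≥ 1.
      have q1 := m1 (2 * k + j)
      have q2 := m1 (2 * k + j')
      have q3 := m1 (2 * k + (i - 1))
      omega
    · exact (sep _ _ ((inBlocks_first hij hj).eq hk1 (inBlocks_second i' j' hij' hj') e).1).elim
    · exact (sep _ _
        ((inBlocks_first hij' hj').eq hk1 (inBlocks_second i j hij hj) e.symm).1).elim
    · obtain ⟨e1, -, e3⟩ :=
        (inBlocks_second i j hij hj).eq hk1 (inBlocks_second i' j' hij' hj') e
      have hi : i = 0 ↔ i' = 0 := by
        have h3 : ∀ i, 3 ∈ secondLeft i ↔ i = 0 := by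
          intro i
          rw [secondLeft]; split_ifs with h <;> simp [h]
        rw [← h3, ← h3, e1]
      have := hTinj _ _ _ _ (by omega) (by omega) (by omega) (by omega)
        (Finset.map_injective _ e3)
      omega

end ShortPaths

/-! ### The cases k = 1 and k = 2 -/

theorem exists_subdivision_kneserGraph_one (r : ℕ) :
    ∃ S : GraphSubdivision (⊤ : SimpleGraph (Fin (r + 2))) (kneserGraph (2 * 1 + r) 1),
      ∀ u v h, (S.path u v h).length = 1 := by
  refine Exists.elim (exists_subdivision_kneserGraph (r := r) (k := 1) le_rfl (fun i => {i + 2})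
    (fun _ _ => 1) (fun i j t => if t = 0 then {i + 2} else {j + 2}) ?_ ?_
    (fun i j _ _ => if_pos rfl) (fun i j _ _ => rfl) ?_ ?_ ?_ ?_) ?_
  · intro i hi; simp; omega
  · intro i _ j _ h
    have := Finset.singleton_injective h
    omega
  · intro i j hij hj t ht
    split_ifs <;> simp <;> omega
  · intro i j hij hj t ht
    obtain rfl : t = 0 := by omega
    simp; omega
  · intro i j hij hj t ht0 ht; omega
  · intro i j i' j' t t' hij hj hij' hj' ht0 ht; omega
  · rintro S ⟨h0, h1, h2, h3, h4, h5⟩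
    refine ⟨S, fun u v h => ?_⟩
    cases u using Fin.cases with
    | zero =>
      cases v using Fin.cases with
      | zero => exact (h.ne rfl).elim
      | succ j => exact h2 _ _
    | succ i =>
      cases v using Fin.cases with
      | zero => exact h3 _ _
      | succ j =>
        rcases lt_or_gt_of_ne (Fin.succ_injective _ |>.ne_iff.1 h.ne) with hij | hij
        · exact h4 i j h hij
        · exact h5 i j h hij

/-- Only consecutive terminals {i+3, i+4} and {i+4, i+5} meet; they are joined through {1, i+5} and
{2, i+3}. All other pairs of terminals are adjacent. -/
theorem exists_subdivision_kneserGraph_two (r : ℕ) :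
    ∃ S : GraphSubdivision (⊤ : SimpleGraph (Fin (r + 2))) (kneserGraph (2 * 2 + r) 2),
      (∀ u v h, (S.path u v h).length = 1 ∨ (S.path u v h).length = 3) ∧
      (S.terminal 0).1 = {1, 2} ∧
        ∀ i : Fin (r + 1), (S.terminal i.succ).1 = {(i : ℕ) + 3, (i : ℕ) + 4} := by
  have ext : ∀ {a b c d : ℕ}, ({a, b} : Finset ℕ) = {c, d} → a = c ∧ b = d ∨ a = d ∧ b = c := by
    intro a b c d h
    have h1 : a ∈ ({c, d} : Finset ℕ) := by rw [← h]; simp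
    have h2 : b ∈ ({c, d} : Finset ℕ) := by rw [← h]; simp
    have h3 : c ∈ ({a, b} : Finset ℕ) := by rw [h]; simp
    have h4 : d ∈ ({a, b} : Finset ℕ) := by rw [h]; simp
    simp only [Finset.mem_insert, Finset.mem_singleton] at h1 h2 h3 h4
    omega
  have sub : ∀ {a b n m : ℕ}, n ≤ a → a < b → b ≤ m →
      ({a, b} : Finset ℕ) ⊆ Finset.Icc n m ∧ ({a, b} : Finset ℕ).card = 2 := by
    intro a b n m h1 h2 h3
    refine ⟨fun x hx => ?_, Finset.card_pair h2.ne⟩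
    simp only [Finset.mem_insert, Finset.mem_singleton] at hx
    rw [Finset.mem_Icc]; omega
  have disj : ∀ {a b c d : ℕ}, a ≠ c → a ≠ d → b ≠ c → b ≠ d →
      Disjoint ({a, b} : Finset ℕ) {c, d} := by
    intro a b c d h1 h2 h3 h4
    rw [Finset.disjoint_left]
    intro x hx hx'
    simp only [Finset.mem_insert, Finset.mem_singleton] at hx hx'
    omega
  have hY : Finset.Icc 1 2 = ({1, 2} : Finset ℕ) := rfl
  let ℓ : ℕ → ℕ → ℕ := fun i j => if j = i + 1 then 3 else 1
  have hℓ : ∀ {i j t : ℕ}, 0 < t → t < ℓ i j → j = i + 1 ∧ (t = 1 ∨ t = 2) := by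
    intro i j t h0 h
    simp only [ℓ] at h
    split_ifs at h <;> omega
  let z : ℕ → ℕ → ℕ → Finset ℕ := fun i j t =>
    if t = 0 then {i + 3, i + 4} else if j ≠ i + 1 then {j + 3, j + 4} else
      if t = 1 then {1, i + 5} else if t = 2 then {2, i + 3} else {j + 3, j + 4}
  have z1 : ∀ i, z i (i + 1) 1 = {1, i + 5} := fun i => by simp [z]
  have z2 : ∀ i, z i (i + 1) 2 = {2, i + 3} := fun i => by simp [z]
  refine Exists.elim (exists_subdivision_kneserGraph (r := r) (k := 2) one_le_two
    (fun i => {i + 3, i + 4}) ℓ z ?_ ?_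
    (fun i j _ _ => if_pos rfl) ?_ ?_ ?_ ?_ ?_) ?_
  · intro i hi; exact sub (by omega) (by omega) (by omega)
  · intro i _ j _ h
    have := ext h
    omega
  · intro i j hij hj
    by_cases h : j = i + 1 <;> simp [ℓ, z, h]
  · intro i j hij hj t ht
    simp only [z]
    split_ifs <;> exact sub (by omega) (by omega) (by omega)
  · intro i j hij hj t ht
    by_cases h : j = i + 1
    · subst h
      have : t < 3 := by simpa [ℓ] using ht
      interval_cases t
      · rw [z1]
        exact disj (by omega) (by omega) (by omega) (by omega)
      · rw [z1, z2]
        exact disj (by omega) (by omega) (by omega) (by omega)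
      · have z3 : z i (i + 1) 3 = {i + 1 + 3, i + 1 + 4} := by simp [z]
        rw [z2, z3]
        exact disj (by omega) (by omega) (by omega) (by omega)
    · have : t < 1 := by simpa [ℓ, h] using ht
      obtain rfl : t = 0 := by omega
      have z3 : z i j 1 = {j + 3, j + 4} := by simp [z, h]
      rw [z3]
      exact disj (by omega) (by omega) (by omega) (by omega)
  · intro i j hij hj t ht0 ht
    obtain ⟨rfl, rfl | rfl⟩ := hℓ ht0 ht
    · rw [z1]
      refine ⟨fun e => ?_, fun l hl e => ?_⟩
      · have := ext (e.trans hY); omega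
      · have := ext e; omega
    · rw [z2]
      refine ⟨fun e => ?_, fun l hl e => ?_⟩
      · have := ext (e.trans hY); omega
      · have := ext e; omega
  · intro i j i' j' t t' hij hj hij' hj' ht0 ht ht0' ht' e
    obtain ⟨rfl, rfl | rfl⟩ := hℓ ht0 ht <;> obtain ⟨rfl, rfl | rfl⟩ := hℓ ht0' ht' <;>
    · simp only [z1, z2] at e
      have := ext e
      omega
  · rintro S ⟨h0, h1, h2, h3, h4, h5⟩
    have hl : ∀ i j, ℓ i j = 1 ∨ ℓ i j = 3 := by
      intro i j; simp only [ℓ]; split_ifs <;> simp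
    refine ⟨S, fun u v h => ?_, h0.trans hY, h1⟩
    cases u using Fin.cases with
    | zero =>
      cases v using Fin.cases with
      | zero => exact (h.ne rfl).elim
      | succ j => exact .inl (h2 _ _)
    | succ i =>
      cases v using Fin.cases with
      | zero => exact .inl (h3 _ _)
      | succ j =>
        rcases lt_or_gt_of_ne (Fin.succ_injective _ |>.ne_iff.1 h.ne) with hij | hij
        · rw [h4 i j h hij]; exact hl _ _
        · rw [h5 i j h hij]; exact hl _ _

/-! ### Assembly of the theorem -/

theorem GraphSubdivision.isTotallyOdd_of_length {V W : Type*} {H : SimpleGraph V}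
    {G : SimpleGraph W} {S : GraphSubdivision H G}
    (h : ∀ u v h, (S.path u v h).length = 1 ∨ (S.path u v h).length = 3) : S.IsTotallyOdd := by
  intro u v e
  rcases h u v e with h | h <;> rw [h] <;> decide

theorem exists_subdivision_of_ge {k r : ℕ} (hk : 1 ≤ k) (hkr : k ≤ r) :
    ∃ S : GraphSubdivision (⊤ : SimpleGraph (Fin (r + 2))) (kneserGraph (2 * k + r) k),
      S.IsTotallyOdd ∧
      (∀ (u v : Fin (r + 2)) (h : (⊤ : SimpleGraph (Fin (r + 2))).Adj u v),
        (S.path u v h).length = 1 ∨ (S.path u v h).length = 3) ∧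
      (k = 2 → (S.terminal 0).1 = {1, 2} ∧
        ∀ i : Fin (r + 1), (S.terminal i.succ).1 = {(i : ℕ) + 3, (i : ℕ) + 4}) ∧
      (3 ≤ k → HasStandardForm k r 3 S) := by
  rcases (by omega : k = 1 ∨ k = 2 ∨ 3 ≤ k) with rfl | rfl | h3
  · obtain ⟨S, hS⟩ := exists_subdivision_kneserGraph_one r
    have h := fun u v h => Or.inl (b := (S.path u v h).length = 3) (hS u v h)
    exact ⟨S, S.isTotallyOdd_of_length h, h, by omega, by omega⟩
  · obtain ⟨S, h, hS⟩ := exists_subdivision_kneserGraph_two r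
    exact ⟨S, S.isTotallyOdd_of_length h, h, fun _ => hS, by omega⟩
  · obtain ⟨S, hS, h⟩ := exists_standardForm_of_ge h3 hkr
    exact ⟨S, S.isTotallyOdd_of_length h, h, by omega, fun _ => hS⟩

theorem exists_subdivision_of_lt {k r : ℕ} (hrk : r < k) :
    ∃ S : GraphSubdivision (⊤ : SimpleGraph (Fin (r + 2))) (kneserGraph (2 * k + r) k),
      S.IsTotallyOdd ∧ HasStandardForm k r (2 * ⌈((k : ℚ) - 1) / (r : ℚ)⌉₊ + 1) S := by
  refine exists_standardForm_of_lt hrk fun hr => ?_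
  have hr' : (0 : ℚ) < r := by exact_mod_cast hr
  have hk' : (0 : ℚ) < (k : ℚ) - 1 := by
    rw [sub_pos]; exact_mod_cast (by omega : 1 < k)
  have hpos : 0 < ⌈((k : ℚ) - 1) / (r : ℚ)⌉₊ := Nat.ceil_pos.2 (div_pos hk' hr')
  have h1 := Nat.le_ceil (((k : ℚ) - 1) / (r : ℚ))
  have h2 := Nat.ceil_lt_add_one (div_pos hk' hr').le
  set m := ⌈((k : ℚ) - 1) / (r : ℚ)⌉₊
  -- Writing the ceiling as n + 1 and k as l + 1 removes the natural subtractions; the bounds become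
  -- l ≤ (n+1)r and nr < l.
  obtain ⟨n, hn⟩ := Nat.exists_eq_add_of_le' hpos
  obtain ⟨l, rfl⟩ := Nat.exists_eq_add_of_le' (by omega : 1 ≤ k)
  rw [hn] at h1 h2 ⊢
  push_cast at h1 h2
  rw [add_sub_cancel_right] at h1 h2
  rw [div_le_iff₀ hr'] at h1
  rw [add_lt_add_iff_right, lt_div_iff₀ hr'] at h2
  rw [Nat.add_sub_cancel, Nat.add_sub_cancel]
  exact ⟨by exact_mod_cast h1, by exact_mod_cast h2⟩

/-- If a graph is `m`-colourable and contains a totally odd subdivision of `K_m`, then it contains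
one of the complete graph on as many vertices as its chromatic number. -/
theorem exists_isTotallyOdd_chromaticNumber {W : Type*} {G : SimpleGraph W} {m : ℕ}
    (hG : G.Colorable m)
    (h : ∃ S : GraphSubdivision (⊤ : SimpleGraph (Fin m)) G, S.IsTotallyOdd) :
    ∃ t : ℕ, G.chromaticNumber = (t : ℕ∞) ∧
      ∃ S : GraphSubdivision (⊤ : SimpleGraph (Fin t)) G, S.IsTotallyOdd := by
  have hle := hG.chromaticNumber_le
  obtain ⟨t, ht⟩ := ENat.ne_top_iff_exists.1 (ne_top_of_le_ne_top (ENat.natCast_ne_top m) hle)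
  rw [← ht, Nat.cast_le] at hle
  obtain ⟨S, hS⟩ := h
  exact ⟨t, ht.symm, S.exists_isTotallyOdd_of_le hle hS⟩

theorem mainTheorem1 :
    -- every Kneser graph contains the complete graph on `χ` vertices as a totally odd subdivision
    (∀ n k : ℕ, k ≤ n →
      ∃ t : ℕ, (kneserGraph n k).chromaticNumber = (t : ℕ∞) ∧
        ∃ S : GraphSubdivision (⊤ : SimpleGraph (Fin t)) (kneserGraph n k), S.IsTotallyOdd) ∧
    -- the case `r ≥ k`: all paths have length `1` or `3`
    (∀ k r : ℕ, 1 ≤ k → k ≤ r →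
      ∃ S : GraphSubdivision (⊤ : SimpleGraph (Fin (r + 2))) (kneserGraph (2 * k + r) k),
        S.IsTotallyOdd ∧
        (∀ (u v : Fin (r + 2)) (h : (⊤ : SimpleGraph (Fin (r + 2))).Adj u v),
          (S.path u v h).length = 1 ∨ (S.path u v h).length = 3) ∧
        (k = 2 → (S.terminal 0).1 = {1, 2} ∧
          ∀ i : Fin (r + 1), (S.terminal i.succ).1 = {(i : ℕ) + 3, (i : ℕ) + 4}) ∧
        (3 ≤ k → HasStandardForm k r 3 S)) ∧
    -- the case `3 ≤ r < k`: the long paths have length `2⌈(k-1)/r⌉ + 1`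
    (∀ k r : ℕ, 3 ≤ r → r < k →
      ∃ S : GraphSubdivision (⊤ : SimpleGraph (Fin (r + 2))) (kneserGraph (2 * k + r) k),
        S.IsTotallyOdd ∧
        HasStandardForm k r (2 * ⌈((k : ℚ) - 1) / (r : ℚ)⌉₊ + 1) S) := by
  refine ⟨fun n k hkn => ?_, fun k r hk hkr => exists_subdivision_of_ge hk hkr,
    fun k r _ hrk => exists_subdivision_of_lt hrk⟩
  by_cases hnk : 1 ≤ k ∧ 2 * k ≤ n
  · obtain ⟨r, rfl⟩ := Nat.exists_eq_add_of_le hnk.2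
    refine exists_isTotallyOdd_chromaticNumber (kneserGraph_colorable hnk.1 r) ?_
    rcases lt_or_ge r k with hrk | hkr
    · obtain ⟨S, hS, -⟩ := exists_subdivision_of_lt hrk
      exact ⟨S, hS⟩
    · obtain ⟨S, hS, -⟩ := exists_subdivision_of_ge hnk.1 hkr
      exact ⟨S, hS⟩
  -- If k = 0 there is a single vertex, and if n < 2k no two k-sets are disjoint. The graph is
  -- edgeless, and since k ≤ n the vertex {1..k} serves as K_1.
  · have hadj : ∀ A B, ¬ (kneserGraph n k).Adj A B := by
      rintro A B ⟨hne, hd⟩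
      have hA := Finset.mem_powersetCard.1 A.2
      have hB := Finset.mem_powersetCard.1 B.2
      rcases Nat.eq_zero_or_pos k with rfl | hk
      · exact hne (Subtype.ext
          ((Finset.card_eq_zero.1 hA.2).trans (Finset.card_eq_zero.1 hB.2).symm))
      · have := Finset.card_le_card (Finset.union_subset hA.1 hB.1)
        rw [Finset.card_union_of_disjoint hd, hA.2, hB.2, Nat.card_Icc] at this
        omega
    refine exists_isTotallyOdd_chromaticNumber (m := 1)
      ⟨SimpleGraph.Coloring.mk (fun _ => 0) fun h => (hadj _ _ h).elim⟩ ?_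
    have hne : ∀ {u v : Fin 1}, ¬ (⊤ : SimpleGraph (Fin 1)).Adj u v := fun h =>
      h.ne (Subsingleton.elim _ _)
    refine ⟨⟨⟨fun _ => ⟨Finset.Icc 1 k, Finset.mem_powersetCard.2
      ⟨Finset.Icc_subset_Icc_right hkn, by simp⟩⟩, fun u v _ => Subsingleton.elim u v⟩,
      fun u v h => (hne h).elim, fun u v h => (hne h).elim, fun u v h => (hne h).elim,
      fun u v h => (hne h).elim, fun u v h => (hne h).elim⟩, fun u v h => (hne h).elim⟩
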